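/- Let $\Xi\subset\mathbb{R}^r$ be convex, $U\in\mathbb{R}^{m\times n}$, $\alpha,\omega>0$ and $\beta,\ell_c,\ell_v\ge 0$. For $\xi\in\Xi$ consider the problem of minimizing $\hat f(x-c(\xi))$ over $x\in\hat{\mathcal X}(\xi):=\{x\in\mathbb{R}^n \mid Ux\le v(\xi)\}$ (componentwise inequality), with all norms Euclidean, where (i) $\hat f:\mathbb{R}^n\to\mathbb{R}$ is twice continuously differentiable and $\alpha$-strongly convex, and $\nabla\hat f$ is $\beta$-Lipschitz; (ii) $c:\Xi\to\mathbb{R}^n$ is $\ell_c$-Lipschitz and $v:\Xi\to\mathbb{R}^m$ is $\ell_v$-Lipschitz; (iii) for every $\xi\in\Xi$ and every $x\in\hat{\mathcal X}(\xi)$, $\omega^2\mathbb{I}\preceq U_{\mathbf I}U_{\mathbf I}^{\top}$, where $\mathbf I=\{i \mid (Ux)_i=v_i(\xi)\}$ is the set of active constraints and $U_{\mathbf I}$ is the submatrix of the corresponding rows of $U$ (no condition if $\mathbf I=\emptyset$). If $\hat{\mathcal X}(\xi)\neq\emptyset$ for every $\xi\in\Xi$, then for every $\xi\in\Xi$ the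 problem has a unique minimizer $x^\star(\xi)\in\mathbb{R}^n$ and a unique multiplier $\mu^\star(\xi)\in\mathbb{R}^m_{\ge0}$ such that $(x^\star(\xi),\mu^\star(\xi))$ satisfies the KKT conditions, that is, $\nabla\hat f(x^\star(\xi)-c(\xi))+U^\top\mu^\star(\xi)=0$ and $\mu_i^\star(\xi)=0$ for every inactive constraint $i$ at $x^\star(\xi)$. The maps $x^\star:\Xi\to\mathbb{R}^n$ and $\mu^\star:\Xi\to\mathbb{R}^m$ are Lipschitz on $\Xi$ with respective Lipschitz constants $$\ell_{x^\star}=\sqrt{\frac{\beta}{\alpha}}\left(\frac{\beta\ell_c}{\alpha}+\frac{\ell_v}{\omega}\right)\qquad\text{and}\qquad \ell_{\mu^\star}=\frac{\beta^{3/2}}{\alpha^{1/2}\,\omega}\left(\frac{\beta\ell_c}{\alpha}+\frac{\ell_v}{\omega}\right).$$ -/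

import Mathlib

open scoped NNReal Matrix

noncomputable section

namespace ParamOpt

/-- Euclidean space `ℝⁿ` with the usual inner product and 2-norm. -/
abbrev E (n : ℕ) : Type := EuclideanSpace ℝ (Fin n)

/-- The feasible set `{x | g x ≤ 0}` of the inequality constraints `g`. -/
def feasibleSet {n m : ℕ} (g : E n → Fin m → ℝ) : Set (E n) :=
  {x | ∀ i, g x i ≤ 0}

open Classical in
/-- The set `{i | g_i x = 0}` of inequality constraints that are active at `x`. -/
def activeSet {n m : ℕ} (g : E n → Fin m → ℝ) (x : E n) : Finset (Fin m) :=
  Finset.univ.filter fun i => g x i = 0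

/-- `x` is a global solution of: minimize `f` subject to `g ≤ 0`. -/
def IsPrimalSolution {n m : ℕ} (f : E n → ℝ) (g : E n → Fin m → ℝ) (x : E n) : Prop :=
  x ∈ feasibleSet g ∧ IsMinOn f (feasibleSet g) x

/-- The Lagrangian `L(x, μ) = f x + μᵀ g x`. -/
def lagrangian {n m : ℕ} (f : E n → ℝ) (g : E n → Fin m → ℝ) (μ : E m) (x : E n) : ℝ :=
  f x + ∑ i, μ i * g x i

/-- The Karush-Kuhn-Tucker conditions for: minimize `f` subject to `g ≤ 0`. -/
structure IsKKTPoint {n m : ℕ} (f : E n → ℝ) (g : E n → Fin m → ℝ)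
    (x : E n) (μ : E m) : Prop where
  feasible : x ∈ feasibleSet g
  nonneg : ∀ i, 0 ≤ μ i
  stationary : gradient (lagrangian f g μ) x = 0
  complementary : ∀ i, i ∉ activeSet g x → μ i = 0

/-- The translated objective `x ↦ f̂ (x - c)`. -/
def transObj {n : ℕ} (fhat : E n → ℝ) (c : E n) : E n → ℝ :=
  fun x => fhat (x - c)

/-- The polyhedral constraint function `x ↦ U x - v`. -/
def polyConstr {n m : ℕ} (U : Matrix (Fin m) (Fin n) ℝ) (v : E m) : E n → Fin m → ℝ :=
  fun x i => (U *ᵥ x.ofLp) i - v i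

/-- The submatrix `U_I` of the rows of `U` with index in `I`. -/
def rowSubmatrix {n m : ℕ} (U : Matrix (Fin m) (Fin n) ℝ) (I : Finset (Fin m)) :
    Matrix I (Fin n) ℝ :=
  U.submatrix (fun i => (i : Fin m)) id

/-- The uniform constraint qualification `ω² 𝕀 ≼ U_I U_Iᵀ` (in the Loewner order), where `I` is the
active set at `x`, for all feasible points `x` of `U x ≤ v ξ` and all parameters `ξ ∈ Ξ`. -/
def UniformLICQ {r n m : ℕ} (Ξ : Set (E r)) (U : Matrix (Fin m) (Fin n) ℝ) (v : E r → E m)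
    (ω : ℝ) : Prop :=
  ∀ ξ ∈ Ξ, ∀ x ∈ feasibleSet (polyConstr U (v ξ)),
    (rowSubmatrix U (activeSet (polyConstr U (v ξ)) x) *
        (rowSubmatrix U (activeSet (polyConstr U (v ξ)) x))ᵀ -
      ω ^ 2 • (1 : Matrix _ _ ℝ)).PosSemidef

end ParamOpt

end

open Set Filter Topology InnerProductSpace

/-! Strong convexity and closedness give a primal solution. The constraint qualification makes the
active rows independent, so testing the first-order condition on suitable directions produces the
multiplier and forces it to be unique.

For the Lipschitz bounds, the parameter is first kept close to a fixed `ξ`. By quadratic growth the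
primal solution is continuous (`IsKKTPoint.tendsto_primal`), so constraints inactive at `ξ` stay
inactive nearby and both multipliers are supported on the active set at `ξ`, where `Uᵀ` is bounded
below by `ω`. With `g` the difference of the gradients, this gives `ω‖Δμ‖ ≤ ‖g‖`, and
complementarity gives `⟪g, Δx⟫ ≤ ‖g‖‖Δv‖/ω`. Together with the interpolation inequality
(`gradient_interpolation`) these yield `‖g‖ ≤ β(‖Δc‖ + ‖Δv‖/ω)` and `√α‖Δx‖ ≤ √β(‖Δc‖ + ‖Δv‖/ω)`,
which is slightly stronger than required. Since the constants do not depend on `ξ`, convexity of `Ξ`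
turns these local estimates into global ones (`lipschitzOnWith_of_eventually_dist_le`). -/

namespace ParamOpt

/-! ### Local-to-global Lipschitz bounds, and inequalities for smooth strongly convex functions. -/

section Analysis

variable {F : Type*} [NormedAddCommGroup F] [InnerProductSpace ℝ F]

/-- A map that is Lipschitz at every point of a convex set, with a uniform constant, is Lipschitz
on that set. -/
theorem lipschitzOnWith_of_eventually_dist_le {X Y : Type*} [NormedAddCommGroup X]
    [NormedSpace ℝ X] [PseudoMetricSpace Y] {s : Set X} (hs : Convex ℝ s) {φ : X → Y} {K : ℝ≥0}
    (h : ∀ a ∈ s, ∀ᶠ b in 𝓝[s] a, dist (φ b) (φ a) ≤ K * dist b a) :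
    LipschitzOnWith K φ s := by
  have hcont : ContinuousOn φ s := fun a ha => by
    rw [ContinuousWithinAt, tendsto_iff_dist_tendsto_zero]
    have h1 : Tendsto (fun b => (K : ℝ) * dist b a) (𝓝[s] a) (𝓝 0) := by
      have : Continuous fun b => (K : ℝ) * dist b a := by fun_prop
      simpa using this.continuousWithinAt (s := s) (x := a) |>.tendsto
    exact squeeze_zero' (Eventually.of_forall fun _ => dist_nonneg) (h a ha) h1
  refine LipschitzOnWith.of_dist_le_mul fun x hx y hy => ?_
  rw [dist_comm (φ x), dist_comm x]
  set γ : ℝ → X := ⇑(AffineMap.lineMap (k := ℝ) x y) with hγ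
  have hγc : Continuous γ := AffineMap.lineMap_continuous
  have hmaps : MapsTo γ (Icc 0 1) s := fun t ht => hs.lineMap_mem hx hy ht
  have hγd (t u : ℝ) : dist (γ t) (γ u) = |t - u| * dist y x := by
    rw [hγ, dist_lineMap_lineMap, Real.dist_eq, dist_comm x]
  -- Continuous induction along the segment: `S` is closed in `[0, 1]`, contains `0`, and extends to
  -- the right of each of its points by the local bound there.
  set S : Set ℝ := {t | dist (φ (γ t)) (φ x) ≤ K * (t * dist y x)} with hS
  have hφγ : ContinuousOn (φ ∘ γ) (Icc 0 1) := hcont.comp hγc.continuousOn hmaps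
  have hclosed : IsClosed (S ∩ Icc 0 1) := by
    have : IsClosed (Icc (0 : ℝ) 1 ∩ {t | dist ((φ ∘ γ) t) (φ x) ≤ K * (t * dist y x)}) :=
      isClosed_Icc.isClosed_le (f := fun t => dist ((φ ∘ γ) t) (φ x))
        (by fun_prop) (by fun_prop)
    rwa [inter_comm] at this
  have hsub : Icc (0 : ℝ) 1 ⊆ S := by
    refine hclosed.Icc_subset_of_forall_exists_gt (by simp [hS, hγ]) fun t ht u hu => ?_
    have ht1 : t ∈ Icc (0 : ℝ) 1 := Ico_subset_Icc_self ht.2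
    have htend : Tendsto γ (𝓝[Icc 0 1] t) (𝓝[s] (γ t)) :=
      hγc.continuousWithinAt.tendsto_nhdsWithin hmaps
    have hev := htend.eventually (h _ (hmaps ht1))
    have hle : 𝓝[>] t ≤ 𝓝[Icc 0 1] t := by
      rw [← nhdsWithin_Ioc_eq_nhdsGT ht.2.2]
      exact nhdsWithin_mono _ fun r hr => ⟨ht1.1.trans hr.1.le, hr.2⟩
    obtain ⟨r, hr, hrd⟩ := ((hev.filter_mono hle).and (Ioc_mem_nhdsGT (mem_Ioi.1 hu))).exists
    refine ⟨r, ?_, hrd⟩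
    have h1 : dist (φ (γ t)) (φ x) ≤ K * (t * dist y x) := ht.1
    have h2 := dist_triangle (φ (γ r)) (φ (γ t)) (φ x)
    have h3 : dist (φ (γ r)) (φ (γ t)) ≤ K * ((r - t) * dist y x) := by
      have := hr
      rwa [hγd, abs_of_pos (sub_pos.2 hrd.1)] at this
    change dist (φ (γ r)) (φ x) ≤ K * (r * dist y x)
    calc _ ≤ K * ((r - t) * dist y x) + K * (t * dist y x) := by linarith
      _ = _ := by ring
  have := hsub (right_mem_Icc.2 zero_le_one)
  simpa [hS, hγ] using this

/-- Baillon–Haddad: a function lying between its tangent planes and their quadratic upper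
perturbations has a cocoercive gradient. -/
theorem norm_sq_le_of_tangent_bounds {h : F → ℝ} {G : F → F} {L : ℝ} (hL : 0 ≤ L)
    (hlow : ∀ y z, h y + inner ℝ (G y) (z - y) ≤ h z)
    (hup : ∀ y z, h z ≤ h y + inner ℝ (G y) (z - y) + L / 2 * ‖z - y‖ ^ 2) (y z : F) :
    ‖G z - G y‖ ^ 2 ≤ L * inner ℝ (G z - G y) (z - y) := by
  -- Gradient steps of length `t` from `z` and from `y` in opposite directions: at each new point
  -- the tangent plane of the other base point lies below the upper quadratic model. The two
  -- inequalities are added.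
  have key (t : ℝ) : (2 * t - L * t ^ 2) * ‖G z - G y‖ ^ 2 ≤ inner ℝ (G z - G y) (z - y) := by
    have h1 := (hlow y (z - t • (G z - G y))).trans (hup z (z - t • (G z - G y)))
    have h2 := (hlow z (y + t • (G z - G y))).trans (hup y (y + t • (G z - G y)))
    have e1 : z - t • (G z - G y) - y = (z - y) - t • (G z - G y) := by abel
    have e2 : z - t • (G z - G y) - z = - (t • (G z - G y)) := by abel
    have e3 : y + t • (G z - G y) - z = t • (G z - G y) - (z - y) := by abel
    have e4 : y + t • (G z - G y) - y = t • (G z - G y) := by abel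
    rw [e1, e2] at h1
    rw [e3, e4] at h2
    have hn : ‖t • (G z - G y)‖ ^ 2 = t ^ 2 * ‖G z - G y‖ ^ 2 := by
      rw [norm_smul, mul_pow, Real.norm_eq_abs, sq_abs]
    have hD : ‖G z - G y‖ ^ 2 = inner ℝ (G z) (G z - G y) - inner ℝ (G y) (G z - G y) := by
      rw [← inner_sub_left, real_inner_self_eq_norm_sq]
    rw [norm_neg, hn] at h1
    rw [hn] at h2
    simp only [inner_sub_right (𝕜 := ℝ) (G z) (t • _), inner_sub_right (𝕜 := ℝ) (G y) (z - y),
      inner_smul_right, inner_neg_right] at h1 h2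
    rw [inner_sub_left]
    linear_combination h1 + h2 + 2 * t * hD
  rcases hL.eq_or_lt with rfl | hL
  · have h0 : ‖G z - G y‖ ^ 2 = 0 := by
      by_contra hne
      -- With `L = 0` the left side of `key` is linear in `t`; this `t` makes it exceed the right
      -- side by `1`.
      have h1 := key ((inner ℝ (G z - G y) (z - y) + 1) / (2 * ‖G z - G y‖ ^ 2))
      have : (2 * ((inner ℝ (G z - G y) (z - y) + 1) / (2 * ‖G z - G y‖ ^ 2)) - 0 *
        ((inner ℝ (G z - G y) (z - y) + 1) / (2 * ‖G z - G y‖ ^ 2)) ^ 2) * ‖G z - G y‖ ^ 2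
          = inner ℝ (G z - G y) (z - y) + 1 := by
        rw [zero_mul, sub_zero, mul_assoc, div_mul_eq_mul_div, mul_div_assoc',
          div_eq_iff (by positivity)]
        ring
      linarith
    rw [h0, zero_mul]
  -- The factor `2t - Lt²` is largest at `t = 1 / L`.
  · have h1 := mul_le_mul_of_nonneg_left (key (1 / L)) hL.le
    have : L * ((2 * (1 / L) - L * (1 / L) ^ 2) * ‖G z - G y‖ ^ 2) = ‖G z - G y‖ ^ 2 := by
      field_simp; ring
    linarith

variable [CompleteSpace F]

theorem hasDerivAt_comp_line {f : F → ℝ} {g : F} {y d : F} {t : ℝ}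
    (hf : HasGradientAt f g (y + t • d)) :
    HasDerivAt (fun s : ℝ => f (y + s • d)) (inner ℝ g d) t := by
  have h1 : HasDerivAt (fun s : ℝ => y + s • d) d t := by
    simpa using ((hasDerivAt_id t).smul_const d).const_add y
  have h2 := hf.hasFDerivAt.comp_hasDerivAt t h1
  rwa [toDual_apply_apply] at h2

theorem _root_.ConvexOn.add_inner_le {h : F → ℝ} (hh : ConvexOn ℝ univ h) {g y : F}
    (hg : HasGradientAt h g y) (z : F) : h y + inner ℝ g (z - y) ≤ h z := by
  have hc : ConvexOn ℝ univ fun s : ℝ => h (y + s • (z - y)) := by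
    have := hh.comp_affineMap (AffineMap.lineMap (k := ℝ) y z)
    rw [preimage_univ] at this
    convert! this using 2 with s
    simp [AffineMap.lineMap_apply, add_comm]
  have hd : HasDerivAt (fun s : ℝ => h (y + s • (z - y))) (inner ℝ g (z - y)) 0 :=
    hasDerivAt_comp_line (by simpa using hg)
  have := hc.le_slope_of_hasDerivAt (mem_univ 0) (mem_univ 1) zero_lt_one hd
  rw [slope_def_field] at this
  simp at this
  linarith

theorem _root_.StrongConvexOn.add_inner_add_le {f : F → ℝ} {α : ℝ}
    (hf : StrongConvexOn univ α f) {g y : F} (hg : HasGradientAt f g y) (z : F) :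
    f y + inner ℝ g (z - y) + α / 2 * ‖z - y‖ ^ 2 ≤ f z := by
  have hn : HasGradientAt (fun x : F => α / 2 * ‖x‖ ^ 2) (α • y) y := by
    rw [hasGradientAt_iff_hasFDerivAt]
    refine ((hasStrictFDerivAt_norm_sq y).hasFDerivAt.const_mul (α / 2)).congr_fderiv ?_
    ext v
    simp
    ring
  have hh := strongConvexOn_iff_convex.1 hf
  have hG : HasGradientAt (fun x : F => f x - α / 2 * ‖x‖ ^ 2) (g - α • y) y := by
    rw [hasGradientAt_iff_hasFDerivAt] at *
    rw [map_sub]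
    exact hg.sub hn
  have := hh.add_inner_le hG z
  have e : ‖z - y‖ ^ 2 = ‖z‖ ^ 2 - 2 * inner ℝ y z + ‖y‖ ^ 2 := by
    rw [norm_sub_sq_real, real_inner_comm]
  have e2 : inner ℝ y (z - y) = inner ℝ y z - ‖y‖ ^ 2 := by
    rw [inner_sub_right, real_inner_self_eq_norm_sq]
  rw [inner_sub_left, inner_smul_left, e2] at this
  simp only [conj_trivial] at this
  rw [e]
  linarith

/-- The gap `ψ` between the quadratic model and `f` along the segment has nonnegative derivative by
Cauchy–Schwarz, which avoids integration. -/
theorem le_add_inner_add_of_lipschitz_gradient {f : F → ℝ} (hf : Differentiable ℝ f) {β : ℝ≥0}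
    (hβ : LipschitzWith β (gradient f)) (y z : F) :
    f z ≤ f y + inner ℝ (gradient f y) (z - y) + β / 2 * ‖z - y‖ ^ 2 := by
  set d := z - y with hd
  set ψ : ℝ → ℝ := fun t =>
    t * inner ℝ (gradient f y) d + β / 2 * ‖d‖ ^ 2 * t ^ 2 - f (y + t • d) with hψ
  have hder (t : ℝ) : HasDerivAt ψ
      (inner ℝ (gradient f y) d + β / 2 * ‖d‖ ^ 2 * (2 * t) - inner ℝ (gradient f (y + t • d)) d)
      t := by
    refine HasDerivAt.sub (HasDerivAt.add ?_ ?_) (hasDerivAt_comp_line (hf _).hasGradientAt)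
    · simpa using (hasDerivAt_id t).mul_const (inner ℝ (gradient f y) d)
    · simpa using (hasDerivAt_pow 2 t).const_mul (β / 2 * ‖d‖ ^ 2)
  have hmono : MonotoneOn ψ (Icc 0 1) := by
    refine monotoneOn_of_deriv_nonneg (convex_Icc 0 1)
      (fun t _ => (hder t).continuousAt.continuousWithinAt)
      (fun t _ => (hder t).differentiableAt.differentiableWithinAt) fun t ht => ?_
    rw [interior_Icc] at ht
    rw [(hder t).deriv]
    have h1 : inner ℝ (gradient f (y + t • d) - gradient f y) d ≤ β * (t * ‖d‖) * ‖d‖ := by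
      refine (real_inner_le_norm _ _).trans (mul_le_mul_of_nonneg_right ?_ (norm_nonneg _))
      have := hβ.dist_le_mul (y + t • d) y
      rwa [dist_eq_norm, dist_eq_norm, add_sub_cancel_left, norm_smul, Real.norm_of_nonneg ht.1.le]
        at this
    rw [inner_sub_left] at h1
    nlinarith
  have := hmono (left_mem_Icc.2 zero_le_one) (right_mem_Icc.2 zero_le_one) zero_le_one
  simp only [hψ, zero_smul, one_smul, add_zero, hd, add_sub_cancel] at this
  rw [hd]
  linarith

/-- The interpolation inequality for the gradient of a strongly convex function with Lipschitz
gradient. -/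
theorem gradient_interpolation {f : F → ℝ} (hf : Differentiable ℝ f) {α β : ℝ≥0} (hαβ : α ≤ β)
    (hconv : StrongConvexOn univ (α : ℝ) f) (hβ : LipschitzWith β (gradient f)) (y z : F) :
    ‖gradient f z - gradient f y - (α : ℝ) • (z - y)‖ ^ 2 ≤
      (β - α) * inner ℝ (gradient f z - gradient f y - (α : ℝ) • (z - y)) (z - y) := by
  have hL : (0 : ℝ) ≤ β - α := sub_nonneg.2 hαβ
  have e (y z : F) : ‖z - y‖ ^ 2 = ‖z‖ ^ 2 - 2 * inner ℝ y z + ‖y‖ ^ 2 := by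
    rw [norm_sub_sq_real, real_inner_comm]
  have e2 (y z : F) : inner ℝ y (z - y) = inner ℝ y z - ‖y‖ ^ 2 := by
    rw [inner_sub_right, real_inner_self_eq_norm_sq]
  -- Removing the quadratic `α/2‖x‖²` leaves a convex function whose upper quadratic bound has
  -- constant `β - α`.
  have := norm_sq_le_of_tangent_bounds (h := fun x => f x - α / 2 * ‖x‖ ^ 2)
    (G := fun x => gradient f x - (α : ℝ) • x) hL
    (fun y z => by
      have := hconv.add_inner_add_le (hf y).hasGradientAt z
      simp only [inner_sub_left, inner_smul_left, e2, conj_trivial]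
      rw [e] at this
      linarith)
    (fun y z => by
      have := le_add_inner_add_of_lipschitz_gradient hf hβ y z
      simp only [inner_sub_left (𝕜 := ℝ) _ _ (z - y), inner_smul_left, e2, conj_trivial]
      rw [e] at this ⊢
      linarith) y z
  have e3 : gradient f z - (α : ℝ) • z - (gradient f y - (α : ℝ) • y) =
      gradient f z - gradient f y - (α : ℝ) • (z - y) := by
    rw [smul_sub]; abel
  simpa only [e3] using this

/-- The lower and upper quadratic bounds are compared at one nonzero point. In the zero space every
pair `α, β` is admissible, hence `Nontrivial`. -/
theorem le_of_strongConvexOn_of_lipschitz_gradient [Nontrivial F] {f : F → ℝ}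
    (hf : Differentiable ℝ f) {α β : ℝ≥0}
    (hconv : StrongConvexOn univ (α : ℝ) f) (hβ : LipschitzWith β (gradient f)) : α ≤ β := by
  obtain ⟨z, hz⟩ := exists_ne (0 : F)
  have h1 := hconv.add_inner_add_le (hf 0).hasGradientAt z
  have h2 := le_add_inner_add_of_lipschitz_gradient hf hβ 0 z
  have h3 : (0 : ℝ) < ‖z - 0‖ ^ 2 := by rw [sub_zero]; positivity
  have : (α : ℝ) ≤ β := by
    by_contra! hlt
    nlinarith
  exact_mod_cast this

end Analysis

/-! ### The perturbation estimate as an inequality between vectors. -/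

section Estimate

variable {F : Type*} [NormedAddCommGroup F] [InnerProductSpace ℝ F] {α β C V : ℝ} {g y c : F}

theorem interpolation_expand
    (hint : ‖g - α • y‖ ^ 2 ≤ (β - α) * inner ℝ (g - α • y) y) :
    ‖g‖ ^ 2 + α * β * ‖y‖ ^ 2 ≤ (α + β) * inner ℝ g y := by
  rw [norm_sub_sq_real, norm_smul, inner_sub_left, inner_smul_left, inner_smul_right,
    real_inner_self_eq_norm_sq, mul_pow, Real.norm_eq_abs, sq_abs] at hint
  simp only [conj_trivial] at hint
  linarith

/-- Here `g`, `c` and `y` stand for the differences of gradients, of centres and of the points `x -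
c`, so `y + c` is the difference of the solutions. Cocoercivity `‖g‖² ≤ β⟪g, y⟫` is combined with
`⟪g, y⟫ = ⟪g, y + c⟫ - ⟪g, c⟫ ≤ ‖g‖(V + C)`, and one factor `‖g‖` cancels. -/
theorem norm_le_of_interpolation (hα : 0 < α) (hαβ : α ≤ β)
    (hint : ‖g - α • y‖ ^ 2 ≤ (β - α) * inner ℝ (g - α • y) y) (hgy : ‖g‖ ≤ β * ‖y‖)
    (hc : ‖c‖ ≤ C) (hV0 : 0 ≤ V) (hV : inner ℝ g (y + c) ≤ ‖g‖ * V) : ‖g‖ ≤ β * (C + V) := by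
  have hβ : 0 < β := hα.trans_le hαβ
  have hint' := interpolation_expand hint
  have hup : inner ℝ g y ≤ β * ‖y‖ ^ 2 := by
    have := real_inner_le_norm g y
    nlinarith [norm_nonneg y]
  have hco : ‖g‖ ^ 2 ≤ β * inner ℝ g y := by nlinarith
  have h1 : inner ℝ g y ≤ ‖g‖ * (C + V) := by
    rw [inner_add_right] at hV
    have := neg_le_of_abs_le (abs_real_inner_le_norm g c)
    nlinarith [norm_nonneg g]
  have h2 : ‖g‖ * ‖g‖ ≤ ‖g‖ * (β * (C + V)) := by nlinarith
  rcases (norm_nonneg g).eq_or_lt with h | h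
  · rw [← h]
    have := (norm_nonneg c).trans hc
    positivity
  · exact le_of_mul_le_mul_left h2 h

theorem sqrt_mul_norm_le_of_interpolation (hα : 0 < α) (hαβ : α ≤ β)
    (hint : ‖g - α • y‖ ^ 2 ≤ (β - α) * inner ℝ (g - α • y) y) (hgy : ‖g‖ ≤ β * ‖y‖)
    (hc : ‖c‖ ≤ C) (hV0 : 0 ≤ V) (hV : inner ℝ g (y + c) ≤ ‖g‖ * V) :
    √α * ‖y + c‖ ≤ √β * (C + V) := by
  have hβ : 0 < β := hα.trans_le hαβ
  have hC0 : 0 ≤ C := (norm_nonneg c).trans hc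
  have hg := norm_le_of_interpolation hα hαβ hint hgy hc hV0 hV
  have hgx : inner ℝ g (y + c) ≤ β * (C + V) * V :=
    hV.trans (mul_le_mul_of_nonneg_right hg hV0)
  -- Eliminating `g` from the interpolation inequality leaves a quadratic inequality in `‖y + c‖`.
  -- The argument divides by `β - α`; when `α = β`, `g = αy` gives it directly.
  have hquad : α * ‖y + c‖ ^ 2 ≤
      α * inner ℝ (y + c) c + (β - α) / 4 * ‖c‖ ^ 2 + β * (C + V) * V := by
    rcases hαβ.eq_or_lt with rfl | hlt
    · rw [sub_self, zero_mul, sq_nonpos_iff, norm_eq_zero, sub_eq_zero] at hint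
      rw [hint, inner_smul_left] at hgx
      have : inner ℝ y (y + c) = ‖y + c‖ ^ 2 - inner ℝ (y + c) c := by
        rw [← real_inner_self_eq_norm_sq (y + c), ← inner_sub_right, add_sub_cancel_right,
          real_inner_comm]
      simp only [conj_trivial, this] at hgx
      linarith
    · have hint' := interpolation_expand hint
      obtain ⟨x, hx⟩ : ∃ x, x = y + c := ⟨_, rfl⟩
      obtain rfl : y = x - c := by rw [hx, add_sub_cancel_right]
      rw [sub_add_cancel] at hgx ⊢
      -- From `(α + β)⟪g, x - c⟫` the part `(β - α)⟪g, x⟫` is split off, being controlled by `hgx`;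
      -- Young's inequality on the remainder cancels `‖g‖²` exactly.
      have hcs : inner ℝ g ((2 * α) • x - (α + β) • c) ≤
          ‖g‖ ^ 2 + ‖(2 * α) • x - (α + β) • c‖ ^ 2 / 4 := by
        have := real_inner_le_norm g ((2 * α) • x - (α + β) • c)
        nlinarith [sq_nonneg (‖g‖ - ‖(2 * α) • x - (α + β) • c‖ / 2)]
      rw [norm_sub_sq_real, norm_smul, norm_smul, mul_pow, mul_pow, Real.norm_eq_abs,
        Real.norm_eq_abs, sq_abs, sq_abs, inner_sub_right, inner_smul_right, inner_smul_right,
        inner_smul_left, inner_smul_right] at hcs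
      simp only [conj_trivial] at hcs
      rw [inner_sub_right, norm_sub_sq_real] at hint'
      have hm := mul_le_mul_of_nonneg_left hgx (sub_nonneg.2 hαβ)
      refine le_of_mul_le_mul_left ?_ (sub_pos.2 hlt)
      linarith
  have hxc : inner ℝ (y + c) c ≤ ‖y + c‖ * C :=
    (real_inner_le_norm _ _).trans (mul_le_mul_of_nonneg_left hc (norm_nonneg _))
  have hc2 : ‖c‖ ^ 2 ≤ C ^ 2 := pow_le_pow_left₀ (norm_nonneg c) hc 2
  have ha : 0 < √α := Real.sqrt_pos.2 hα
  have hab : √α ≤ √β := Real.sqrt_le_sqrt hαβ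
  have ha2 : √α ^ 2 = α := Real.sq_sqrt hα.le
  have hb2 : √β ^ 2 = β := Real.sq_sqrt hβ.le
  have hX := norm_nonneg (y + c)
  set X := ‖y + c‖
  set a := √α
  set b := √β
  rw [← ha2, ← hb2] at hquad
  have hba : 0 ≤ b ^ 2 - a ^ 2 := by nlinarith
  have hquad' : a ^ 2 * X ^ 2 ≤
      a ^ 2 * (X * C) + (b ^ 2 - a ^ 2) / 4 * C ^ 2 + b ^ 2 * (C + V) * V := by
    have h1 := mul_le_mul_of_nonneg_left hxc (sq_nonneg a)
    have h2 := mul_le_mul_of_nonneg_left hc2 (by positivity : 0 ≤ (b ^ 2 - a ^ 2) / 4)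
    linarith
  by_contra! hlt
  have hS : a * C ≤ b * (C + V) := by
    have : a * C ≤ b * C := mul_le_mul_of_nonneg_right hab hC0
    have : 0 ≤ b * V := by positivity
    linarith
  -- The quadratic `s² - aCs` is larger at `s = aX` than at `s = b(C + V)`. With `hquad'` this
  -- contradicts `b(b - a)(C + V)C ≥ (b² - a²)C²/4`, which holds because `4b ≥ a + b`.
  have h1 : 0 < (a * X - b * (C + V)) * (a * X + b * (C + V) - a * C) := by
    have : 0 ≤ b * (C + V) := by positivity
    exact mul_pos (by linarith) (by linarith)
  have h2 : b * (b - a) * ((C + V) * C) < (b - a) * (b + a) / 4 * C ^ 2 := by linarith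
  have h3 : 0 ≤ (b - a) * (3 * b - a) / 4 * C ^ 2 := by
    have : 0 ≤ (b - a) * (3 * b - a) := mul_nonneg (by linarith) (by linarith)
    positivity
  have h4 : 0 ≤ b * (b - a) * (V * C) :=
    mul_nonneg (mul_nonneg (by positivity) (by linarith)) (by positivity)
  linarith

end Estimate
end ParamOpt

/-! ### Linear algebra of the active constraints. -/

namespace ParamOpt

/-- The continuous linear map `x ↦ U x`. -/
noncomputable def constrMap {n m : ℕ} (U : Matrix (Fin m) (Fin n) ℝ) : E n →L[ℝ] E m :=
  LinearMap.toContinuousLinearMap (Matrix.toEuclideanLin U)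

variable {n m : ℕ} {U : Matrix (Fin m) (Fin n) ℝ} {I : Finset (Fin m)}

theorem polyConstr_eq (U : Matrix (Fin m) (Fin n) ℝ) (v : E m) (x : E n) (i : Fin m) :
    polyConstr U v x i = constrMap U x i - v i := rfl

theorem mem_feasibleSet_polyConstr {v : E m} {x : E n} :
    x ∈ feasibleSet (polyConstr U v) ↔ ∀ i, constrMap U x i ≤ v i := by
  simp [feasibleSet, polyConstr_eq]

theorem mem_activeSet_polyConstr {v : E m} {x : E n} {i : Fin m} :
    i ∈ activeSet (polyConstr U v) x ↔ constrMap U x i = v i := by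
  simp [activeSet, polyConstr_eq, sub_eq_zero]

theorem adjoint_constrMap_apply (U : Matrix (Fin m) (Fin n) ℝ) (ν : E m) :
    (constrMap U).adjoint ν = WithLp.toLp 2 (Uᵀ *ᵥ ν.ofLp) := by
  have h := Matrix.toEuclideanLin_conjTranspose_eq_adjoint (𝕜 := ℝ) U
  rw [Matrix.conjTranspose_eq_transpose_of_trivial] at h
  rw [LinearMap.adjoint_eq_toCLM_adjoint] at h
  exact (congrArg (fun L : E m →ₗ[ℝ] E n => L ν) h).symm

/-- The constraint qualification as a lower bound for `Uᵀ` on multipliers supported on `I`. -/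
theorem mul_norm_le_norm_adjoint {ω : ℝ}
    (h : (rowSubmatrix U I * (rowSubmatrix U I)ᵀ - ω ^ 2 • (1 : Matrix _ _ ℝ)).PosSemidef)
    {ν : E m} (hν : ∀ i ∉ I, ν i = 0) : ω * ‖ν‖ ≤ ‖(constrMap U).adjoint ν‖ := by
  have hsum (φ : Fin m → ℝ) : ∑ i, ν i * φ i = ∑ i : I, ν i * φ i := by
    rw [Finset.sum_coe_sort I (fun i => ν i * φ i)]
    refine (Finset.sum_subset (Finset.subset_univ I) fun i _ hi => ?_).symm
    rw [hν i hi, zero_mul]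
  set w : I → ℝ := fun i => ν i with hw
  have hB : (rowSubmatrix U I)ᵀ *ᵥ w = Uᵀ *ᵥ ν.ofLp := by
    ext j
    simp only [Matrix.mulVec, dotProduct, rowSubmatrix, Matrix.transpose_apply,
      Matrix.submatrix_apply, id, hw]
    simpa [mul_comm] using (hsum fun i => U i j).symm
  have h1 := h.dotProduct_mulVec_nonneg w
  rw [Matrix.sub_mulVec, dotProduct_sub, ← Matrix.mulVec_mulVec, Matrix.dotProduct_mulVec,
    Matrix.smul_mulVec, Matrix.one_mulVec, dotProduct_smul, star_trivial,
    ← Matrix.mulVec_transpose, hB] at h1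
  have hnν : ‖ν‖ ^ 2 = w ⬝ᵥ w := by
    rw [EuclideanSpace.norm_sq_eq]
    simpa [dotProduct, sq] using hsum fun i => ν i
  have hnA : ‖(constrMap U).adjoint ν‖ ^ 2 = (Uᵀ *ᵥ ν.ofLp) ⬝ᵥ (Uᵀ *ᵥ ν.ofLp) := by
    rw [EuclideanSpace.norm_sq_eq, adjoint_constrMap_apply]
    simp [dotProduct, sq]
  rw [← hnν, ← hnA, smul_eq_mul] at h1
  refine le_of_sq_le_sq ?_ (norm_nonneg _)
  rw [mul_pow]
  linarith

/-- If `Uᵀ` is bounded below on vectors supported on `I`, then `U Uᵀ` has a right inverse on the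
coordinates in `I`, with values supported on `I`. -/
theorem exists_rightInverse_on {ω : ℝ} (hω : 0 < ω)
    (h : ∀ ν : E m, (∀ i ∉ I, ν i = 0) → ω * ‖ν‖ ≤ ‖(constrMap U).adjoint ν‖) :
    ∃ Λ : E m →L[ℝ] E m, ∀ w, (∀ i ∉ I, Λ w i = 0) ∧
      ∀ i ∈ I, constrMap U ((constrMap U).adjoint (Λ w)) i = w i := by
  classical
  set A := constrMap U with hA
  let P : E m →ₗ[ℝ] E m :=
    { toFun := fun ν => WithLp.toLp 2 fun i => if i ∈ I then ν i else 0
      map_add' := fun x y => by ext i; by_cases hi : i ∈ I <;> simp [hi]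
      map_smul' := fun t x => by ext i; by_cases hi : i ∈ I <;> simp [hi] }
  have hP (ν : E m) (i : Fin m) : P ν i = if i ∈ I then ν i else 0 := rfl
  have hPoff (ν : E m) : ∀ i ∉ I, P ν i = 0 := fun i hi => by rw [hP, if_neg hi]
  -- The block `U_I U_Iᵀ` is completed by the identity off `I`, so that injectivity of an
  -- endomorphism of `E m` gives the inverse.
  let T : E m →ₗ[ℝ] E m := P ∘ₗ (A ∘L A.adjoint).toLinearMap ∘ₗ P + (LinearMap.id - P)
  have hT (ν : E m) (i : Fin m) :
      T ν i = if i ∈ I then A (A.adjoint (P ν)) i else ν i := by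
    by_cases hi : i ∈ I <;> simp [T, hP, hi]
  have hinj : Function.Injective T := by
    rw [injective_iff_map_eq_zero]
    intro ν hν
    have hi (i : Fin m) : (if i ∈ I then A (A.adjoint (P ν)) i else ν i) = 0 := by
      rw [← hT, hν]; rfl
    have h0 : inner ℝ (A (A.adjoint (P ν))) (P ν) = 0 := by
      rw [PiLp.inner_apply]
      refine Finset.sum_eq_zero fun i _ => ?_
      have := hi i
      split_ifs at this with hm
      · rw [this, inner_zero_left]
      · rw [hPoff ν i hm, inner_zero_right]
    rw [← ContinuousLinearMap.adjoint_inner_right, real_inner_self_eq_norm_sq, sq_eq_zero_iff] at h0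
    have h1 := h (P ν) (hPoff ν)
    rw [h0] at h1
    have h2 : P ν = 0 := norm_le_zero_iff.1 (nonpos_of_mul_nonpos_right h1 hω)
    ext i
    by_cases hm : i ∈ I
    · have := hP ν i
      rw [if_pos hm, h2] at this
      exact this.symm
    · have := hi i
      rwa [if_neg hm] at this
  let Te := LinearEquiv.ofInjectiveEndo T hinj
  refine ⟨LinearMap.toContinuousLinearMap (P ∘ₗ Te.symm.toLinearMap), fun w =>
    ⟨hPoff _, fun i hi => ?_⟩⟩
  have h1 : T (Te.symm w) = w := Te.apply_symm_apply w
  have h2 := hT (Te.symm w) i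
  rw [h1, if_pos hi] at h2
  exact h2.symm

/-! ### Existence, uniqueness and KKT characterization of solutions for a fixed parameter. -/

section KKT

variable {f : E n → ℝ} {c x : E n} {v μ : E m}

theorem gradient_lagrangian (hf : Differentiable ℝ f) :
    gradient (lagrangian (transObj f c) (polyConstr U v) μ) x =
      gradient f (x - c) + (constrMap U).adjoint μ := by
  refine HasGradientAt.gradient ?_
  rw [hasGradientAt_iff_hasFDerivAt, map_add]
  have h1 : HasFDerivAt (transObj f c) (toDual ℝ (E n) (gradient f (x - c))) x :=
    (hasFDerivAt_comp_sub c).2 (hf (x - c)).hasGradientAt.hasFDerivAt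
  have e : (fun x => ∑ i, μ i * polyConstr U v x i) =
      fun x => inner ℝ ((constrMap U).adjoint μ) x - inner ℝ μ v := by
    ext x
    rw [ContinuousLinearMap.adjoint_inner_left, ← inner_sub_right, PiLp.inner_apply]
    simp [polyConstr_eq, mul_comm]
  have h2 : HasFDerivAt (fun x => ∑ i, μ i * polyConstr U v x i)
      (toDual ℝ (E n) ((constrMap U).adjoint μ)) x := by
    rw [e]
    exact (toDual ℝ (E n) ((constrMap U).adjoint μ)).hasFDerivAt.sub_const _
  exact h1.add h2

theorem IsKKTPoint.gradient_eq (hf : Differentiable ℝ f)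
    (h : IsKKTPoint (transObj f c) (polyConstr U v) x μ) :
    gradient f (x - c) = - (constrMap U).adjoint μ := by
  rw [eq_neg_iff_add_eq_zero, ← gradient_lagrangian hf, h.stationary]

theorem inner_sub_nonpos_of_feasible (hμ : ∀ i, 0 ≤ μ i)
    (hx : x ∈ feasibleSet (polyConstr U v)) : inner ℝ μ (constrMap U x - v) ≤ 0 := by
  rw [PiLp.inner_apply]
  refine Finset.sum_nonpos fun i _ => ?_
  have := mul_nonpos_of_nonpos_of_nonneg (hx i) (hμ i)
  simpa [polyConstr_eq] using this

theorem IsKKTPoint.inner_sub_eq_zero {F : E n → ℝ}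
    (h : IsKKTPoint F (polyConstr U v) x μ) : inner ℝ μ (constrMap U x - v) = 0 := by
  rw [PiLp.inner_apply]
  refine Finset.sum_eq_zero fun i _ => ?_
  by_cases hi : i ∈ activeSet (polyConstr U v) x
  · simp [mem_activeSet_polyConstr.1 hi]
  · simp [h.complementary i hi]

/-- Quadratic growth of the objective at a KKT point, under perturbation of the parameters. -/
theorem IsKKTPoint.growth {α : ℝ} (hf : Differentiable ℝ f) (hconv : StrongConvexOn univ α f)
    (h : IsKKTPoint (transObj f c) (polyConstr U v) x μ) {c' z : E n} {v' : E m}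
    (hz : z ∈ feasibleSet (polyConstr U v')) :
    f (x - c) - inner ℝ μ (v' - v) - inner ℝ (gradient f (x - c)) (c' - c) +
      α / 2 * ‖(z - c') - (x - c)‖ ^ 2 ≤ f (z - c') := by
  have h1 := hconv.add_inner_add_le (hf (x - c)).hasGradientAt (z - c')
  have h2 := inner_sub_nonpos_of_feasible h.nonneg hz
  have h3 := h.inner_sub_eq_zero
  have h4 : inner ℝ (gradient f (x - c)) (z - x) = - inner ℝ μ (constrMap U z - constrMap U x) := by
    rw [h.gradient_eq hf, inner_neg_left, ContinuousLinearMap.adjoint_inner_left, map_sub]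
  have e : (z - c') - (x - c) = (z - x) - (c' - c) := by abel
  rw [e, inner_sub_right, h4] at h1
  rw [e]
  simp only [inner_sub_right μ] at *
  linarith

theorem IsKKTPoint.isPrimalSolution_iff {α : ℝ} (hα : 0 < α) (hf : Differentiable ℝ f)
    (hconv : StrongConvexOn univ α f) (h : IsKKTPoint (transObj f c) (polyConstr U v) x μ)
    {z : E n} : IsPrimalSolution (transObj f c) (polyConstr U v) z ↔ z = x := by
  have hg {z} (hz : z ∈ feasibleSet (polyConstr U v)) :
      f (x - c) + α / 2 * ‖z - x‖ ^ 2 ≤ f (z - c) := by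
    simpa using h.growth hf hconv (c' := c) hz
  constructor
  · rintro ⟨hz, hmin⟩
    have h1 : f (z - c) ≤ f (x - c) := hmin h.feasible
    have h2 := hg hz
    have h3 : ‖z - x‖ ^ 2 ≤ 0 := by
      by_contra! hlt
      nlinarith
    rwa [sq_nonpos_iff, norm_eq_zero, sub_eq_zero] at h3
  · intro hzx
    rw [hzx]
    refine ⟨h.feasible, fun z hz => ?_⟩
    have := hg hz
    have h3 : 0 ≤ α / 2 * ‖z - x‖ ^ 2 := by positivity
    change f (x - c) ≤ f (z - c)
    linarith

theorem exists_isPrimalSolution {α : ℝ} (hα : 0 < α) (hf : Differentiable ℝ f)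
    (hconv : StrongConvexOn univ α f) (hne : (feasibleSet (polyConstr U v)).Nonempty) :
    ∃ x, IsPrimalSolution (transObj f c) (polyConstr U v) x := by
  obtain ⟨x₀, hx₀⟩ := hne
  have hclosed : IsClosed (feasibleSet (polyConstr U v)) := by
    have : feasibleSet (polyConstr U v) = ⋂ i, {x | constrMap U x i ≤ v i} := by
      ext; simp [mem_feasibleSet_polyConstr]
    rw [this]
    exact isClosed_iInter fun i => isClosed_le (by fun_prop) continuous_const
  have hcont : Continuous (transObj f c) := hf.continuous.comp (by fun_prop)
  set g := gradient f (x₀ - c)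
  have hev : ∀ᶠ z in cocompact (E n) ⊓ 𝓟 (feasibleSet (polyConstr U v)),
      transObj f c x₀ ≤ transObj f c z := by
    refine Eventually.filter_mono inf_le_left ?_
    -- Beyond this radius the term `α/2‖z - x₀‖²` dominates the linear term `‖g‖‖z - x₀‖`.
    filter_upwards [(isCompact_closedBall x₀ (2 * ‖g‖ / α)).compl_mem_cocompact] with z hz
    have hz' : 2 * ‖g‖ / α < ‖z - x₀‖ := by
      simpa [dist_eq_norm] using hz
    rw [div_lt_iff₀ hα] at hz'
    have h1 := hconv.add_inner_add_le (hf (x₀ - c)).hasGradientAt (z - c)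
    rw [sub_sub_sub_cancel_right] at h1
    have h2 := neg_le_of_abs_le (abs_real_inner_le_norm g (z - x₀))
    change f (x₀ - c) ≤ f (z - c)
    nlinarith [norm_nonneg (z - x₀)]
  obtain ⟨x, hx, hmin⟩ := hcont.continuousOn.exists_isMinOn' hclosed hx₀ hev
  exact ⟨x, hx, hmin⟩

/-- First-order necessary condition along directions that keep the active constraints satisfied. -/
theorem IsPrimalSolution.inner_gradient_nonneg (hf : Differentiable ℝ f)
    (h : IsPrimalSolution (transObj f c) (polyConstr U v) x) {d : E n}
    (hd : ∀ i ∈ activeSet (polyConstr U v) x, constrMap U d i ≤ 0) :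
    0 ≤ inner ℝ (gradient f (x - c)) d := by
  have hfeas : ∀ᶠ t : ℝ in 𝓝[>] 0, x + t • d ∈ feasibleSet (polyConstr U v) := by
    simp only [mem_feasibleSet_polyConstr]
    refine eventually_all.2 fun i => ?_
    by_cases hi : i ∈ activeSet (polyConstr U v) x
    · filter_upwards [self_mem_nhdsWithin] with t ht
      have := mul_nonpos_of_nonneg_of_nonpos (le_of_lt ht) (hd i hi)
      simp [mem_activeSet_polyConstr.1 hi, this]
    · have hlt : constrMap U x i < v i :=
        lt_of_le_of_ne (mem_feasibleSet_polyConstr.1 h.1 i) (mt mem_activeSet_polyConstr.2 hi)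
      have hc : Continuous fun t : ℝ => constrMap U (x + t • d) i := by fun_prop
      have ht : Tendsto (fun t : ℝ => constrMap U (x + t • d) i) (𝓝 0) (𝓝 (constrMap U x i)) := by
        simpa using hc.tendsto 0
      exact ((ht.eventually_lt_const hlt).filter_mono nhdsWithin_le_nhds).mono fun _ h => h.le
  have hder : HasDerivAt (fun t : ℝ => f (x - c + t • d)) (inner ℝ (gradient f (x - c)) d) 0 :=
    hasDerivAt_comp_line (by simpa using (hf (x - c)).hasGradientAt)
  have hslope := (hasDerivWithinAt_iff_tendsto_slope' self_notMem_Ioi).1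
    (hder.hasDerivWithinAt (s := Ioi 0))
  refine ge_of_tendsto hslope ?_
  filter_upwards [hfeas, self_mem_nhdsWithin] with t ht ht0
  have h1 : f (x - c) ≤ f (x + t • d - c) := h.2 ht
  rw [slope_def_field]
  refine div_nonneg ?_ (by simpa using le_of_lt ht0)
  rw [add_sub_right_comm] at h1
  simpa using h1

theorem IsPrimalSolution.exists_isKKTPoint {ω : ℝ} (hω : 0 < ω) (hf : Differentiable ℝ f)
    (h : IsPrimalSolution (transObj f c) (polyConstr U v) x)
    (hU : ∀ ν : E m, (∀ i ∉ activeSet (polyConstr U v) x, ν i = 0) →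
      ω * ‖ν‖ ≤ ‖(constrMap U).adjoint ν‖) :
    ∃ μ, IsKKTPoint (transObj f c) (polyConstr U v) x μ := by
  classical
  obtain ⟨Λ, hΛ⟩ := exists_rightInverse_on hω hU
  set A := constrMap U
  set g := gradient f (x - c) with hg
  have horth {ν : E m} {d : E n} (hν : ∀ i ∉ activeSet (polyConstr U v) x, ν i = 0)
      (hd : ∀ i ∈ activeSet (polyConstr U v) x, A d i = 0) : inner ℝ (A.adjoint ν) d = 0 := by
    rw [ContinuousLinearMap.adjoint_inner_left, PiLp.inner_apply]
    refine Finset.sum_eq_zero fun i _ => ?_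
    by_cases hi : i ∈ activeSet (polyConstr U v) x
    · rw [hd i hi, inner_zero_right]
    · rw [hν i hi, inner_zero_left]
  obtain ⟨hoff, hon⟩ := hΛ (A g)
  -- `e` is the orthogonal projection of `g` onto the span of the active rows. Since `e - g` is
  -- tangent to the active constraints, it is an admissible direction, and the first-order condition
  -- forces `e = g`.
  set e := A.adjoint (Λ (A g)) with he
  have hker : ∀ i ∈ activeSet (polyConstr U v) x, A (e - g) i = 0 := fun i hi => by
    rw [map_sub, PiLp.sub_apply, hon i hi, sub_self]
  have h0 : 0 ≤ inner ℝ g (e - g) := h.inner_gradient_nonneg hf fun i hi => (hker i hi).le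
  have h1 : inner ℝ e (e - g) = 0 := horth hoff hker
  have hge : e - g = 0 := by
    have : ‖e - g‖ ^ 2 = inner ℝ e (e - g) - inner ℝ g (e - g) := by
      rw [← inner_sub_left, real_inner_self_eq_norm_sq]
    rw [← norm_eq_zero, ← sq_nonpos_iff]
    linarith
  have hge' : g = A.adjoint (Λ (A g)) := (sub_eq_zero.1 hge).symm
  refine ⟨- Λ (A g), h.1, fun i => ?_, ?_, fun i hi => ?_⟩
  · by_cases hi : i ∈ activeSet (polyConstr U v) x
    -- This direction moves strictly inside constraint `i` and keeps the other active ones tight, so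
    -- `⟪g, d⟫` is exactly the `i`-th multiplier.
    · set d := A.adjoint (Λ (EuclideanSpace.single i (-1)))
      have hd : ∀ j ∈ activeSet (polyConstr U v) x, A d j = EuclideanSpace.single i (-1 : ℝ) j :=
        (hΛ _).2
      have h2 : 0 ≤ inner ℝ g d := h.inner_gradient_nonneg hf fun j hj => by
        refine (hd j hj).trans_le ?_
        by_cases hji : j = i <;> simp [hji]
      rw [hge', ContinuousLinearMap.adjoint_inner_left, PiLp.inner_apply] at h2
      rw [Finset.sum_eq_single i (fun j _ hji => ?_) (by simp), hd i hi] at h2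
      · simpa using h2
      · by_cases hj : j ∈ activeSet (polyConstr U v) x
        · rw [hd j hj]; simp [hji]
        · rw [hoff j hj, inner_zero_left]
    · simp [hoff i hi]
  · rw [gradient_lagrangian hf, map_neg, ← hge', ← hg, add_neg_cancel]
  · simp [hoff i hi]

theorem IsKKTPoint.multiplier_unique {ω : ℝ} (hω : 0 < ω) (hf : Differentiable ℝ f)
    (hU : ∀ ν : E m, (∀ i ∉ activeSet (polyConstr U v) x, ν i = 0) →
      ω * ‖ν‖ ≤ ‖(constrMap U).adjoint ν‖) {μ' : E m}
    (h : IsKKTPoint (transObj f c) (polyConstr U v) x μ)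
    (h' : IsKKTPoint (transObj f c) (polyConstr U v) x μ') : μ' = μ := by
  have h1 := hU (μ' - μ) fun i hi => by
    rw [PiLp.sub_apply, h.complementary i hi, h'.complementary i hi, sub_zero]
  have h2 : (constrMap U).adjoint (μ' - μ) = 0 := by
    rw [map_sub, sub_eq_zero, ← neg_inj, ← h.gradient_eq hf, ← h'.gradient_eq hf]
  rw [h2, norm_zero] at h1
  exact sub_eq_zero.1 (norm_le_zero_iff.1 (nonpos_of_mul_nonpos_right h1 hω))

end KKT

/-! ### Continuity of the primal solution and the quantitative comparison of KKT points. -/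

section Perturbation

variable {f : E n → ℝ}

/-- The primal solution depends continuously on the parameters. -/
theorem IsKKTPoint.tendsto_primal {ι : Type*} {l : Filter ι} {α ω : ℝ} (hα : 0 < α) (hω : 0 < ω)
    (hf : Differentiable ℝ f) (hconv : StrongConvexOn univ α f)
    {c₀ x₀ : E n} {v₀ μ₀ : E m} {c x : ι → E n} {v : ι → E m}
    (h : IsKKTPoint (transObj f c₀) (polyConstr U v₀) x₀ μ₀)
    (hU : ∀ ν : E m, (∀ i ∉ activeSet (polyConstr U v₀) x₀, ν i = 0) →
      ω * ‖ν‖ ≤ ‖(constrMap U).adjoint ν‖)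
    (hx : ∀ᶠ a in l, IsPrimalSolution (transObj f (c a)) (polyConstr U (v a)) (x a))
    (hc : Tendsto c l (𝓝 c₀)) (hv : Tendsto v l (𝓝 v₀)) : Tendsto x l (𝓝 x₀) := by
  obtain ⟨Λ, hΛ⟩ := exists_rightInverse_on hω hU
  set A := constrMap U with hA
  -- A competitor for the perturbed problem: it makes the old active constraints tight again, and
  -- the others stay slack near `x₀`. Optimality of `x a` against `z a`, with quadratic growth at
  -- `x₀`, gives `hbound`.
  set z : ι → E n := fun a => x₀ + A.adjoint (Λ (v a - v₀)) with hz
  have hzlim : Tendsto z l (𝓝 x₀) := by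
    have : Tendsto (fun w => x₀ + A.adjoint (Λ (w - v₀))) (𝓝 v₀) (𝓝 x₀) := by
      have hcont : Continuous fun w => x₀ + A.adjoint (Λ (w - v₀)) := by fun_prop
      simpa using hcont.tendsto v₀
    exact this.comp hv
  have hzfeas : ∀ᶠ a in l, z a ∈ feasibleSet (polyConstr U (v a)) := by
    simp only [mem_feasibleSet_polyConstr]
    refine eventually_all.2 fun i => ?_
    by_cases hi : i ∈ activeSet (polyConstr U v₀) x₀
    · refine Eventually.of_forall fun a => ?_
      have := (hΛ (v a - v₀)).2 i hi
      have h2 := mem_activeSet_polyConstr.1 hi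
      rw [← hA] at h2
      rw [← hA, hz, map_add, PiLp.add_apply, this, h2, PiLp.sub_apply, add_sub_cancel]
    · have hlt : A x₀ i < v₀ i :=
        lt_of_le_of_ne (mem_feasibleSet_polyConstr.1 h.feasible i)
          (mt mem_activeSet_polyConstr.2 hi)
      have h1 : Tendsto (fun a => A (z a) i) l (𝓝 (A x₀ i)) := by
        have hcont : Continuous fun y => A y i := by fun_prop
        exact (hcont.tendsto x₀).comp hzlim
      have h2 : Tendsto (fun a => v a i) l (𝓝 (v₀ i)) := by
        have hcont : Continuous fun y : E m => y i := by fun_prop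
        exact (hcont.tendsto v₀).comp hv
      exact (h1.eventually_lt h2 hlt).mono fun _ h => h.le
  set y₀ := x₀ - c₀
  set g₀ := gradient f y₀
  have hbound : ∀ᶠ a in l, ‖(x a - c a) - y₀‖ ^ 2 ≤ 2 / α *
      (f (z a - c a) - f y₀ + inner ℝ μ₀ (v a - v₀) + inner ℝ g₀ (c a - c₀)) := by
    filter_upwards [hx, hzfeas] with a ha hza
    have h1 := h.growth hf hconv (c' := c a) ha.1
    have h2 : f (x a - c a) ≤ f (z a - c a) := ha.2 hza
    rw [div_mul_eq_mul_div, le_div_iff₀ hα]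
    linarith
  have hlim : Tendsto (fun a => 2 / α *
      (f (z a - c a) - f y₀ + inner ℝ μ₀ (v a - v₀) + inner ℝ g₀ (c a - c₀))) l (𝓝 0) := by
    have hcont : Continuous fun p : E n × E n × E m => 2 / α *
      (f (p.1 - p.2.1) - f y₀ + inner ℝ μ₀ (p.2.2 - v₀) + inner ℝ g₀ (p.2.1 - c₀)) := by
      have := hf.continuous
      fun_prop
    have := (hcont.tendsto (x₀, c₀, v₀)).comp (hzlim.prodMk_nhds (hc.prodMk_nhds hv))
    simpa [y₀, Function.comp_def] using this
  have hsq := squeeze_zero' (Eventually.of_forall fun _ => sq_nonneg _) hbound hlim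
  have hy : Tendsto (fun a => x a - c a) l (𝓝 y₀) := by
    rw [tendsto_iff_norm_sub_tendsto_zero]
    have := hsq.sqrt
    simpa using this
  simpa [y₀] using hy.add hc

/-- Comparison of two KKT points whose multipliers are supported on a common set of constraints
satisfying the constraint qualification. -/
theorem IsKKTPoint.dist_le {α β : ℝ≥0} {ω : ℝ} (hα : 0 < α) (hω : 0 < ω)
    (hf : Differentiable ℝ f) (hconv : StrongConvexOn univ (α : ℝ) f)
    (hβ : LipschitzWith β (gradient f)) (hU : ∀ ν : E m, (∀ i ∉ I, ν i = 0) →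
      ω * ‖ν‖ ≤ ‖(constrMap U).adjoint ν‖)
    {c₁ c₂ x₁ x₂ : E n} {v₁ v₂ μ₁ μ₂ : E m}
    (h₁ : IsKKTPoint (transObj f c₁) (polyConstr U v₁) x₁ μ₁)
    (h₂ : IsKKTPoint (transObj f c₂) (polyConstr U v₂) x₂ μ₂)
    (hI₁ : ∀ i ∉ I, μ₁ i = 0) (hI₂ : ∀ i ∉ I, μ₂ i = 0) :
    dist x₂ x₁ ≤ √(β / α) * (β / α * dist c₂ c₁ + dist v₂ v₁ / ω) ∧
      dist μ₂ μ₁ ≤ β / ω * √(β / α) * (β / α * dist c₂ c₁ + dist v₂ v₁ / ω) := by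
  simp only [dist_eq_norm]
  set A := constrMap U
  set y := (x₂ - c₂) - (x₁ - c₁) with hy
  set g := gradient f (x₂ - c₂) - gradient f (x₁ - c₁) with hg
  have hgA : g = - A.adjoint (μ₂ - μ₁) := by
    rw [hg, h₁.gradient_eq hf, h₂.gradient_eq hf, map_sub]; abel
  have hμ : ω * ‖μ₂ - μ₁‖ ≤ ‖g‖ := by
    rw [hgA, norm_neg]
    exact hU _ fun i hi => by rw [PiLp.sub_apply, hI₁ i hi, hI₂ i hi, sub_zero]
  have hgy : ‖g‖ ≤ β * ‖y‖ := by
    simpa [dist_eq_norm] using hβ.dist_le_mul (x₂ - c₂) (x₁ - c₁)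
  have hα' : (0 : ℝ) < α := hα
  -- For `n = 0` the inequality `α ≤ β` may fail, but then both differences vanish.
  rcases subsingleton_or_nontrivial (E n) with hn | hn
  · have e1 : x₂ - x₁ = 0 := Subsingleton.elim _ _
    have e2 : ‖g‖ = 0 := by rw [Subsingleton.elim g 0, norm_zero]
    rw [e2] at hμ
    have e3 := nonpos_of_mul_nonpos_right hμ hω
    rw [e1, norm_zero]
    exact ⟨by positivity, e3.trans (by positivity)⟩
  have hαβ : (α : ℝ) ≤ β := le_of_strongConvexOn_of_lipschitz_gradient hf hconv hβ
  have hx : y + (c₂ - c₁) = x₂ - x₁ := by rw [hy]; abel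
  have hinner : inner ℝ g (y + (c₂ - c₁)) ≤ ‖g‖ * (‖v₂ - v₁‖ / ω) := by
    have m1 := h₁.inner_sub_eq_zero
    have m2 := h₂.inner_sub_eq_zero
    have m3 := inner_sub_nonpos_of_feasible h₁.nonneg h₂.feasible
    have m4 := inner_sub_nonpos_of_feasible h₂.nonneg h₁.feasible
    have e1 : inner ℝ g (y + (c₂ - c₁)) = - inner ℝ (μ₂ - μ₁) (A x₂ - A x₁) := by
      rw [hx, hgA, inner_neg_left, ContinuousLinearMap.adjoint_inner_left, map_sub]
    -- Each multiplier is orthogonal to its own slack and has nonpositive product with the other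
    -- point's `Ux - v`.
    have e2 : - inner ℝ (μ₂ - μ₁) (A x₂ - A x₁) ≤ - inner ℝ (μ₂ - μ₁) (v₂ - v₁) := by
      simp only [inner_sub_left, inner_sub_right] at *
      linarith
    have e3 := neg_le_of_abs_le (abs_real_inner_le_norm (μ₂ - μ₁) (v₂ - v₁))
    have e4 : ‖μ₂ - μ₁‖ * ‖v₂ - v₁‖ ≤ ‖g‖ * (‖v₂ - v₁‖ / ω) := by
      rw [mul_div_assoc', le_div_iff₀ hω, mul_right_comm, mul_comm _ ω]
      exact mul_le_mul_of_nonneg_right hμ (norm_nonneg _)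
    linarith
  have hint := gradient_interpolation hf (by exact_mod_cast hαβ) hconv hβ (x₁ - c₁) (x₂ - c₂)
  have hV0 : 0 ≤ ‖v₂ - v₁‖ / ω := by positivity
  have hX := sqrt_mul_norm_le_of_interpolation hα' hαβ hint hgy le_rfl hV0 hinner
  have hG := norm_le_of_interpolation hα' hαβ hint hgy le_rfl hV0 hinner
  rw [hx] at hX
  have hκ : 1 ≤ (β : ℝ) / α := (one_le_div hα').2 hαβ
  have hκ' : 1 ≤ √((β : ℝ) / α) := Real.one_le_sqrt.2 hκ
  -- The estimates hold with `‖c₂ - c₁‖` alone; the factor `β / α` here, and `√(β / α)` in the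
  -- multiplier bound, are only weakenings by numbers at least `1`.
  have hS : ‖c₂ - c₁‖ + ‖v₂ - v₁‖ / ω ≤ β / α * ‖c₂ - c₁‖ + ‖v₂ - v₁‖ / ω :=
    add_le_add_left (le_mul_of_one_le_left (norm_nonneg _) hκ) _
  constructor
  · refine le_trans ?_ (mul_le_mul_of_nonneg_left hS (Real.sqrt_nonneg _))
    rw [Real.sqrt_div' _ hα'.le, div_mul_eq_mul_div, le_div_iff₀ (Real.sqrt_pos.2 hα'), mul_comm]
    exact hX
  · calc ‖μ₂ - μ₁‖ ≤ β * (‖c₂ - c₁‖ + ‖v₂ - v₁‖ / ω) / ω := by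
          rw [le_div_iff₀ hω, mul_comm]
          exact hμ.trans hG
      _ = β / ω * (‖c₂ - c₁‖ + ‖v₂ - v₁‖ / ω) := by ring
      _ ≤ β / ω * √(β / α) * (‖c₂ - c₁‖ + ‖v₂ - v₁‖ / ω) :=
          mul_le_mul_of_nonneg_right (le_mul_of_one_le_right (by positivity) hκ') (by positivity)
      _ ≤ _ := mul_le_mul_of_nonneg_left hS (by positivity)

end Perturbation
end ParamOpt

/-! ### Assembly: local stability of the active set and globalization over `Ξ`. -/

theorem mainTheorem5 {r n m : ℕ} (Ξ : Set (ParamOpt.E r)) (hΞ : Convex ℝ Ξ)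
    (fhat : ParamOpt.E n → ℝ) (c : ParamOpt.E r → ParamOpt.E n)
    (v : ParamOpt.E r → ParamOpt.E m) (U : Matrix (Fin m) (Fin n) ℝ)
    (α β ω ℓc ℓv : ℝ≥0) (hα : 0 < α) (hω : 0 < ω)
    (hf : ContDiff ℝ 2 fhat) (hconv : StrongConvexOn Set.univ (α : ℝ) fhat)
    (hsmooth : LipschitzWith β (gradient fhat))
    (hc : LipschitzOnWith ℓc c Ξ) (hv : LipschitzOnWith ℓv v Ξ)
    (hU : ParamOpt.UniformLICQ Ξ U v (ω : ℝ))
    (hfeas : ∀ ξ ∈ Ξ, (ParamOpt.feasibleSet (ParamOpt.polyConstr U (v ξ))).Nonempty) :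
    ∃ (xstar : ParamOpt.E r → ParamOpt.E n) (μstar : ParamOpt.E r → ParamOpt.E m),
      (∀ ξ ∈ Ξ, ∀ x, ParamOpt.IsPrimalSolution (ParamOpt.transObj fhat (c ξ))
          (ParamOpt.polyConstr U (v ξ)) x ↔ x = xstar ξ) ∧
      (∀ ξ ∈ Ξ, ∀ μ, ParamOpt.IsKKTPoint (ParamOpt.transObj fhat (c ξ))
          (ParamOpt.polyConstr U (v ξ)) (xstar ξ) μ ↔ μ = μstar ξ) ∧
      LipschitzOnWith (NNReal.sqrt (β / α) * (β * ℓc / α + ℓv / ω)) xstar Ξ ∧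
      LipschitzOnWith
        (β ^ (3 / 2 : ℝ) / (α ^ (1 / 2 : ℝ) * ω) * (β * ℓc / α + ℓv / ω)) μstar Ξ := by
  have hα' : (0 : ℝ) < α := hα
  have hω' : (0 : ℝ) < ω := hω
  have hdiff : Differentiable ℝ fhat := hf.differentiable (by norm_num)
  have hlow (ξ) (hξ : ξ ∈ Ξ) (x) (hx : x ∈ ParamOpt.feasibleSet (ParamOpt.polyConstr U (v ξ)))
      (ν : ParamOpt.E m)
      (hν : ∀ i ∉ ParamOpt.activeSet (ParamOpt.polyConstr U (v ξ)) x, ν i = 0) :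
      ω * ‖ν‖ ≤ ‖(ParamOpt.constrMap U).adjoint ν‖ :=
    ParamOpt.mul_norm_le_norm_adjoint (hU ξ hξ x hx) hν
  have hex (ξ : ParamOpt.E r) : ∃ p : ParamOpt.E n × ParamOpt.E m, ξ ∈ Ξ →
      ParamOpt.IsKKTPoint (ParamOpt.transObj fhat (c ξ)) (ParamOpt.polyConstr U (v ξ)) p.1 p.2 := by
    by_cases hξ : ξ ∈ Ξ
    · obtain ⟨x, hx⟩ :=
        ParamOpt.exists_isPrimalSolution (c := c ξ) hα' hdiff hconv (hfeas ξ hξ)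
      obtain ⟨μ, hμ⟩ := hx.exists_isKKTPoint hω' hdiff (hlow ξ hξ x hx.1)
      exact ⟨(x, μ), fun _ => hμ⟩
    · exact ⟨0, fun h => absurd h hξ⟩
  choose p hp using hex
  have hprimal (ξ) (hξ : ξ ∈ Ξ) (x) : ParamOpt.IsPrimalSolution (ParamOpt.transObj fhat (c ξ))
      (ParamOpt.polyConstr U (v ξ)) x ↔ x = (p ξ).1 :=
    (hp ξ hξ).isPrimalSolution_iff hα' hdiff hconv
  have hlocal (ξ) (hξ : ξ ∈ Ξ) : ∀ᶠ η in 𝓝[Ξ] ξ,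
      dist (p η).1 (p ξ).1 ≤
        √(β / α) * (β / α * dist (c η) (c ξ) + dist (v η) (v ξ) / ω) ∧
      dist (p η).2 (p ξ).2 ≤
        β / ω * √(β / α) * (β / α * dist (c η) (c ξ) + dist (v η) (v ξ) / ω) := by
    have hvt : Tendsto v (𝓝[Ξ] ξ) (𝓝 (v ξ)) := hv.continuousOn ξ hξ
    have hxt : Tendsto (fun η => (p η).1) (𝓝[Ξ] ξ) (𝓝 (p ξ).1) :=
      (hp ξ hξ).tendsto_primal hα' hω' hdiff hconv (hlow ξ hξ _ (hp ξ hξ).feasible)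
        (by filter_upwards [self_mem_nhdsWithin] with η hη using (hprimal η hη _).2 rfl)
        (hc.continuousOn ξ hξ) hvt
    -- Active sets can only shrink near `ξ`, so the active set at `ξ` supports both multipliers. For
    -- distant parameters no common support need satisfy the qualification, hence the local
    -- argument.
    have hact : ∀ᶠ η in 𝓝[Ξ] ξ, ∀ i,
        i ∉ ParamOpt.activeSet (ParamOpt.polyConstr U (v ξ)) (p ξ).1 →
        i ∉ ParamOpt.activeSet (ParamOpt.polyConstr U (v η)) (p η).1 := by
      refine eventually_all.2 fun i => eventually_imp_distrib_left.2 fun hi => ?_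
      have h1 : Tendsto (fun η => ParamOpt.constrMap U (p η).1 i) (𝓝[Ξ] ξ)
          (𝓝 (ParamOpt.constrMap U (p ξ).1 i)) := by
        have hcont : Continuous fun y => ParamOpt.constrMap U y i := by fun_prop
        exact (hcont.tendsto _).comp hxt
      have h2 : Tendsto (fun η => v η i) (𝓝[Ξ] ξ) (𝓝 (v ξ i)) := by
        have hcont : Continuous fun y : ParamOpt.E m => y i := by fun_prop
        exact (hcont.tendsto _).comp hvt
      rw [ParamOpt.mem_activeSet_polyConstr] at hi
      filter_upwards [(h1.sub h2).eventually_ne (sub_ne_zero.2 hi)] with η hη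
      rwa [ParamOpt.mem_activeSet_polyConstr, ← sub_eq_zero]
    filter_upwards [hact, self_mem_nhdsWithin] with η hη hηΞ
    exact ParamOpt.IsKKTPoint.dist_le hα hω' hdiff hconv hsmooth
      (hlow ξ hξ _ (hp ξ hξ).feasible) (hp ξ hξ) (hp η hηΞ) (hp ξ hξ).complementary
      fun i hi => (hp η hηΞ).complementary i (hη i hi)
  have hdata (ξ) (hξ : ξ ∈ Ξ) (η) (hη : η ∈ Ξ) :
      (β / α * dist (c η) (c ξ) + dist (v η) (v ξ) / ω : ℝ) ≤
        (β * ℓc / α + ℓv / ω) * dist η ξ := by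
    have h1 := mul_le_mul_of_nonneg_left (hc.dist_le_mul η hη ξ hξ)
      (by positivity : (0 : ℝ) ≤ β / α)
    have h2 := div_le_div_of_nonneg_right (hv.dist_le_mul η hη ξ hξ) hω'.le
    calc _ ≤ (β / α : ℝ) * (ℓc * dist η ξ) + ℓv * dist η ξ / ω := add_le_add h1 h2
      _ = _ := by ring
  have hconst : (β : ℝ) / ω * √(β / α) = β ^ (3 / 2 : ℝ) / (α ^ (1 / 2 : ℝ) * ω) := by
    have e : (β : ℝ) ^ (3 / 2 : ℝ) = β * √β := by
      rw [Real.sqrt_eq_rpow, ← Real.rpow_one_add' β.coe_nonneg (by norm_num)]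
      norm_num
    rw [e, ← Real.sqrt_eq_rpow, Real.sqrt_div' _ hα'.le]
    field_simp
  refine ⟨fun ξ => (p ξ).1, fun ξ => (p ξ).2, hprimal, fun ξ hξ μ => ⟨fun h => ?_, ?_⟩,
    ParamOpt.lipschitzOnWith_of_eventually_dist_le hΞ fun ξ hξ => ?_,
    ParamOpt.lipschitzOnWith_of_eventually_dist_le hΞ fun ξ hξ => ?_⟩
  · exact (hp ξ hξ).multiplier_unique hω' hdiff (hlow ξ hξ _ (hp ξ hξ).feasible) h
  · rintro rfl
    exact hp ξ hξ
  · filter_upwards [hlocal ξ hξ, self_mem_nhdsWithin] with η hη hηΞ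
    push_cast
    rw [mul_assoc]
    exact hη.1.trans (mul_le_mul_of_nonneg_left (hdata ξ hξ η hηΞ) (Real.sqrt_nonneg _))
  · filter_upwards [hlocal ξ hξ, self_mem_nhdsWithin] with η hη hηΞ
    push_cast
    rw [mul_assoc, ← hconst]
    exact hη.2.trans (mul_le_mul_of_nonneg_left (hdata ξ hξ η hηΞ) (by positivity))
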